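/- Let $M$ be a smooth $n$-dimensional manifold and let $\Pi^1(M,M)\rightrightarrows M$ be its groupoid of 1-jets of local diffeomorphisms, whose arrows $j^1_{x,y}\phi$ from $x$ to $y$ are the linear isomorphisms $T_xM\to T_yM$. Let $\Pi^1_G(M,M)$ be a reduced Lie subgroupoid of $\Pi^1(M,M)$, i.e. a transitive Lie groupoid over $M$ with an injective immersion into $\Pi^1(M,M)$ that is a groupoid morphism over $\mathrm{id}_M$; write $\alpha,\beta$ for its source and target maps and $\Pi^1_G(U,V)=\alpha^{-1}(U)\cap\beta^{-1}(V)$ for open $U,V\subseteq M$. Charts $\psi_U:U\to\overline U$ and $\psi_V:V\to\overline V$ of $M$ (onto open subsets of $\mathbb{R}^n$) assign to a 1-jet $j=j^1_{x,y}\phi$ with $x\in U$, $y\in V$ the linear map $$\overline\Psi_{U,V}(j)=T_y\psi_V\circ T_x\phi\circ (T_x\psi_U)^{-1}\in GL(n,\mathbb{R}).$$ For an (immersed) Lie subgroup $G$ of $GL(n,\mathbb{R})$ the standard flat groupoid with group $G$ is the groupoid $\mathbb{R}^n\times\mathbb{R}^n\times G\rightrightarrows\mathbb{R}^n$ in which $(x,y,a)$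 goes from $x$ to $y$ and $(y,z,b)\cdot(x,y,a)=(x,z,ba)$. We say that $\Pi^1_G(M,M)$ is locally diffeomorphic to it if for all $x,y\in M$ there are charts $\psi_U:U\to\overline U$ with $x\in U$ and $\psi_V:V\to\overline V$ with $y\in V$ such that $$\Psi_{U,V}=(\psi_U\circ\alpha,\ \psi_V\circ\beta,\ \overline\Psi_{U,V})$$ is a diffeomorphism from $\Pi^1_G(U,V)$ onto $\overline U\times\overline V\times G$, and that $\Pi^1_G(M,M)$ is integrable if it is locally diffeomorphic to $\mathbb{R}^n\times\mathbb{R}^n\times G\rightrightarrows\mathbb{R}^n$ for some Lie subgroup $G$ of $GL(n,\mathbb{R})$. Then $\Pi^1_G(M,M)$ is integrable if and only if, for some Lie subgroup $G$ of $GL(n,\mathbb{R})$, the manifold $M$ can be covered by charts $\psi_U:U\to\overline U$ each of which induces, by $\Psi_{U,U}=(\psi_U\circ\alpha,\psi_U\circ\beta,\overline\Psi_{U,U})$, a Lie groupoid isomorphism over $\psi_U$ from $\Pi^1_G(U,U)$ onto the restriction $\overline U\times\overline U\times G$ to $\overline U$ of the standard flat groupoid with group $G$. Moreover, for each Lie subgroup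 $G$ of $GL(n,\mathbb{R})$, $\Pi^1_G(M,M)$ is locally diffeomorphic to $\mathbb{R}^n\times\mathbb{R}^n\times G\rightrightarrows\mathbb{R}^n$ if and only if $M$ can be covered by such charts for this $G$. -/

import Mathlib

open Set Bundle Manifold TopologicalSpace
open scoped ContDiff

noncomputable section

namespace JetGroupoids

/-! ### Groupoids and Lie groupoids -/

/-- A groupoid with set of objects `M` and set of arrows `Γ`. An arrow `g` goes from `src g` to
`tgt g`, and the composite `mul g h` (first `h`, then `g`) is meaningful when `src g = tgt h`;
its value on other pairs is irrelevant and nothing is required of it. -/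
structure GroupoidOver (M Γ : Type*) where
  src : Γ → M
  tgt : Γ → M
  one : M → Γ
  inv : Γ → Γ
  mul : Γ → Γ → Γ
  src_mul : ∀ g h, src g = tgt h → src (mul g h) = src h
  tgt_mul : ∀ g h, src g = tgt h → tgt (mul g h) = tgt g
  mul_assoc : ∀ g h k, src g = tgt h → src h = tgt k → mul g (mul h k) = mul (mul g h) k
  src_one : ∀ x, src (one x) = x
  tgt_one : ∀ x, tgt (one x) = x
  mul_one : ∀ g, mul g (one (src g)) = g
  one_mul : ∀ g, mul (one (tgt g)) g = g
  src_inv : ∀ g, src (inv g) = tgt g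
  tgt_inv : ∀ g, tgt (inv g) = src g
  inv_mul : ∀ g, mul (inv g) g = one (src g)
  mul_inv : ∀ g, mul g (inv g) = one (tgt g)

namespace GroupoidOver

variable {M Γ : Type*}

/-- The arrows with source in `U` and target in `V`. -/
def arrows (𝒢 : GroupoidOver M Γ) (U V : Set M) : Set Γ :=
  {g | 𝒢.src g ∈ U ∧ 𝒢.tgt g ∈ V}

/-- The pairs of composable arrows. -/
def composable (𝒢 : GroupoidOver M Γ) : Set (Γ × Γ) :=
  {p | 𝒢.src p.1 = 𝒢.tgt p.2}

/-- A groupoid is transitive if any two objects are joined by an arrow. -/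
def IsTransitive (𝒢 : GroupoidOver M Γ) : Prop :=
  ∀ x y : M, ∃ g : Γ, 𝒢.src g = x ∧ 𝒢.tgt g = y

/-- A groupoid on smooth manifolds `M`, `Γ` is a Lie groupoid if source and target are submersions
and the remaining structure maps are smooth (the multiplication as a map on the submanifold of
composable pairs). -/
structure IsLie {E H E' H' : Type*} [NormedAddCommGroup E] [NormedSpace ℝ E] [TopologicalSpace H]
    [NormedAddCommGroup E'] [NormedSpace ℝ E'] [TopologicalSpace H']
    (I : ModelWithCorners ℝ E H) (J : ModelWithCorners ℝ E' H')
    [TopologicalSpace M] [ChartedSpace H M] [TopologicalSpace Γ] [ChartedSpace H' Γ]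
    (𝒢 : GroupoidOver M Γ) : Prop where
  src_submersion : IsSubmersion J I ∞ 𝒢.src
  tgt_submersion : IsSubmersion J I ∞ 𝒢.tgt
  one_smooth : ContMDiff I J ∞ 𝒢.one
  inv_smooth : ContMDiff J J ∞ 𝒢.inv
  mul_smooth : ContMDiffOn (J.prod J) J ∞ (fun p : Γ × Γ => 𝒢.mul p.1 p.2) 𝒢.composable

/-- The trivial groupoid `M × M × G` over `M` with group `G`; the arrow `(x, y, a)` goes from `x`
to `y`, and `(y, z, b) · (x, y, a) = (x, z, b a)`. -/
def trivial (M G : Type*) [Group G] : GroupoidOver M (M × M × G) where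
  src p := p.1
  tgt p := p.2.1
  one x := (x, x, 1)
  inv p := (p.2.1, p.1, p.2.2⁻¹)
  mul p q := (q.1, p.2.1, p.2.2 * q.2.2)
  src_mul _ _ _ := rfl
  tgt_mul _ _ _ := rfl
  mul_assoc _ _ _ _ _ := by simp [_root_.mul_assoc]
  src_one _ := rfl
  tgt_one _ := rfl
  mul_one _ := by simp
  one_mul _ := by simp
  src_inv _ := rfl
  tgt_inv _ := rfl
  inv_mul _ := by simp
  mul_inv _ := by simp

/-- `Φ` is a Lie groupoid isomorphism over `φ` from the restriction of `𝒢₁` to the open set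
`φ.source` onto the restriction of `𝒢₂` to the open set `φ.target`: a diffeomorphism between the
open sets of arrows of these restrictions, which together with `φ` respects source, target and
composition. -/
structure IsLieIsoOn {M₁ Γ₁ M₂ Γ₂ E₁ H₁ E₂ H₂ : Type*}
    [NormedAddCommGroup E₁] [NormedSpace ℝ E₁] [TopologicalSpace H₁]
    [NormedAddCommGroup E₂] [NormedSpace ℝ E₂] [TopologicalSpace H₂]
    {J₁ : ModelWithCorners ℝ E₁ H₁} {J₂ : ModelWithCorners ℝ E₂ H₂}
    [TopologicalSpace M₁] [TopologicalSpace M₂]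
    [TopologicalSpace Γ₁] [ChartedSpace H₁ Γ₁] [TopologicalSpace Γ₂] [ChartedSpace H₂ Γ₂]
    (𝒢₁ : GroupoidOver M₁ Γ₁) (𝒢₂ : GroupoidOver M₂ Γ₂)
    (Φ : PartialDiffeomorph J₁ J₂ Γ₁ Γ₂ ∞) (φ : OpenPartialHomeomorph M₁ M₂) : Prop where
  source_eq : Φ.source = 𝒢₁.arrows φ.source φ.source
  target_eq : Φ.target = 𝒢₂.arrows φ.target φ.target
  map_src : ∀ g ∈ Φ.source, 𝒢₂.src (Φ g) = φ (𝒢₁.src g)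
  map_tgt : ∀ g ∈ Φ.source, 𝒢₂.tgt (Φ g) = φ (𝒢₁.tgt g)
  map_mul : ∀ g ∈ Φ.source, ∀ h ∈ Φ.source, 𝒢₁.src g = 𝒢₁.tgt h →
    Φ (𝒢₁.mul g h) = 𝒢₂.mul (Φ g) (Φ h)

end GroupoidOver

/-! ### The groupoid of 1-jets -/

/-- Euclidean space `ℝⁿ`. -/
abbrev Rn (n : ℕ) := EuclideanSpace ℝ (Fin n)

section OneJets

variable (n : ℕ) (M : Type*) [TopologicalSpace M] [ChartedSpace (Rn n) M]

/-- The bundle over `M × M` with fibre `T_x M` over `(x, y)`. -/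
abbrev tangentSrc : M × M → Type :=
  (ContMDiffMap.fst : C^∞⟮(𝓡 n).prod (𝓡 n), M × M; 𝓡 n, M⟯) *ᵖ (TangentSpace (𝓡 n) : M → Type)

/-- The bundle over `M × M` with fibre `T_y M` over `(x, y)`. -/
abbrev tangentTgt : M × M → Type :=
  (ContMDiffMap.snd : C^∞⟮(𝓡 n).prod (𝓡 n), M × M; 𝓡 n, M⟯) *ᵖ (TangentSpace (𝓡 n) : M → Type)

instance instAddCommGroupTangentSrc (p : M × M) : AddCommGroup (tangentSrc n M p) :=
  inferInstanceAs (AddCommGroup (TangentSpace (𝓡 n) p.1))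

instance instAddCommGroupTangentTgt (p : M × M) : AddCommGroup (tangentTgt n M p) :=
  inferInstanceAs (AddCommGroup (TangentSpace (𝓡 n) p.2))

instance instIsTopologicalAddGroupTangentTgt (p : M × M) :
    IsTopologicalAddGroup (tangentTgt n M p) :=
  inferInstanceAs (IsTopologicalAddGroup (TangentSpace (𝓡 n) p.2))

instance instContinuousSMulTangentTgt (p : M × M) : ContinuousSMul ℝ (tangentTgt n M p) :=
  inferInstanceAs (ContinuousSMul ℝ (TangentSpace (𝓡 n) p.2))

/-- The total space of the smooth vector bundle over `M × M` whose fibre over `(x, y)` is the space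
of linear maps `T_x M → T_y M`. -/
abbrev LinJet :=
  TotalSpace (Rn n →L[ℝ] Rn n) (fun p : M × M => tangentSrc n M p →L[ℝ] tangentTgt n M p)

variable [IsManifold (𝓡 n) ∞ M]

theorem isOpen_isInvertible : IsOpen {j : LinJet n M | j.2.IsInvertible} := by
  rw [isOpen_iff_mem_nhds]
  intro j hj
  set e₁ := trivializationAt (Rn n) (tangentSrc n M) j.proj with he₁
  set e₂ := trivializationAt (Rn n) (tangentTgt n M) j.proj with he₂
  set e := trivializationAt (Rn n →L[ℝ] Rn n)
    (fun p : M × M => tangentSrc n M p →L[ℝ] tangentTgt n M p) j.proj with he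
  have hsrc : ∀ q ∈ e.source, q.proj ∈ e₁.baseSet ∩ e₂.baseSet := by
    intro q hq
    exact e.mem_source.1 hq
  have key : ∀ q ∈ e.source, ((e q).2.IsInvertible ↔ q.2.IsInvertible) := by
    intro q hq
    obtain ⟨h1, h2⟩ := hsrc q hq
    have : (e q).2 = (e₂.continuousLinearEquivAt ℝ q.proj h2 : _ →L[ℝ] _).comp
        (q.2.comp ((e₁.continuousLinearEquivAt ℝ q.proj h1).symm : _ →L[ℝ] _)) := by
      rw [e₂.coe_continuousLinearEquivAt_eq' (R := ℝ) h2,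
        e₁.symm_continuousLinearEquivAt_eq' (R := ℝ) h1]
      rfl
    rw [this]
    exact ContinuousLinearMap.isInvertible_equiv_comp.trans
      ContinuousLinearMap.isInvertible_comp_equiv
  have hO : IsOpen {A : Rn n →L[ℝ] Rn n | A.IsInvertible} := ContinuousLinearEquiv.isOpen
  have hjs : j ∈ e.source := FiberBundle.mem_trivializationAt_proj_source
  have hopen : IsOpen (e.source ∩ e ⁻¹' (Prod.snd ⁻¹' {A : Rn n →L[ℝ] Rn n | A.IsInvertible})) :=
    e.continuousOn_toFun.isOpen_inter_preimage e.open_source (hO.preimage continuous_snd)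
  exact Filter.mem_of_superset (hopen.mem_nhds ⟨hjs, (key j hjs).2 hj⟩)
    fun q hq => (key q hq.1).1 hq.2

/-- The manifold `Π¹(M, M)` of 1-jets of local diffeomorphisms of `M`: the jet `j¹_{x,y} φ` is the
linear isomorphism `T_x φ : T_x M → T_y M`. It is an open submanifold of the total space of
the bundle of linear maps `T_x M → T_y M`. -/
abbrev OneJet : Type _ :=
  (⟨{j : LinJet n M | j.2.IsInvertible}, isOpen_isInvertible n M⟩ : Opens (LinJet n M))

/-- The model with corners of the manifold `Π¹(M, M)`. -/
abbrev jetModel (n : ℕ) := ((𝓡 n).prod (𝓡 n)).prod 𝓘(ℝ, Rn n →L[ℝ] Rn n)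

namespace OneJet

variable {n M}

/-- The source of a jet. -/
def src (j : OneJet n M) : M := j.1.proj.1

/-- The target of a jet. -/
def tgt (j : OneJet n M) : M := j.1.proj.2

/-- The linear isomorphism `T_x M → T_y M` that a jet from `x` to `y` is. -/
def lin (j : OneJet n M) : TangentSpace (𝓡 n) j.src →L[ℝ] TangentSpace (𝓡 n) j.tgt := j.1.2

/-- The jet given by a linear isomorphism. -/
def mk (x y : M) (L : TangentSpace (𝓡 n) x →L[ℝ] TangentSpace (𝓡 n) y) (hL : L.IsInvertible) :
    OneJet n M := ⟨⟨(x, y), L⟩, hL⟩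

theorem lin_isInvertible (j : OneJet n M) : j.lin.IsInvertible := j.2

theorem mk_lin (j : OneJet n M) : mk j.src j.tgt j.lin j.lin_isInvertible = j := rfl

theorem isInvertible_inverse (j : OneJet n M) : j.lin.inverse.IsInvertible := by
  obtain ⟨A, hA⟩ := j.lin_isInvertible
  rw [← hA, ContinuousLinearMap.inverse_equiv]
  exact ContinuousLinearMap.isInvertible_equiv

/-- The composition of jets. All tangent spaces are modelled on the same type `ℝⁿ`, so the formula
makes sense for all pairs; it is the composition of jets when `g.src = h.tgt`. -/
def comp (g h : OneJet n M) : OneJet n M :=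
  mk h.src g.tgt (ContinuousLinearMap.comp (M₂ := Rn n) g.lin h.lin)
    (ContinuousLinearMap.IsInvertible.comp (M₂ := Rn n) g.lin_isInvertible h.lin_isInvertible)

end OneJet

open OneJet in
/-- The groupoid of 1-jets `Π¹(M, M)` over `M`. -/
def jetGroupoid : GroupoidOver M (OneJet n M) where
  src := src
  tgt := tgt
  one x := mk x x (.id ℝ _) ⟨.refl ℝ _, rfl⟩
  inv j := mk j.tgt j.src j.lin.inverse j.isInvertible_inverse
  mul := comp
  src_mul _ _ _ := rfl
  tgt_mul _ _ _ := rfl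
  mul_assoc _ _ _ _ _ := rfl
  src_one _ := rfl
  tgt_one _ := rfl
  mul_one _ := rfl
  one_mul _ := rfl
  src_inv _ := rfl
  tgt_inv _ := rfl
  inv_mul j := by
    have h : (j.lin.inverse).comp j.lin = .id ℝ _ := by
      obtain ⟨A, hA⟩ := j.lin_isInvertible
      rw [← hA, ContinuousLinearMap.inverse_equiv, ContinuousLinearEquiv.coe_symm_comp_coe]
    apply Subtype.ext
    exact congrArg (fun L => (⟨(j.src, j.src), L⟩ : LinJet n M)) h
  mul_inv j := by
    have h : j.lin.comp (j.lin.inverse) = .id ℝ _ := by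
      obtain ⟨A, hA⟩ := j.lin_isInvertible
      rw [← hA, ContinuousLinearMap.inverse_equiv, ContinuousLinearEquiv.coe_comp_coe_symm]
    apply Subtype.ext
    exact congrArg (fun L => (⟨(j.tgt, j.tgt), L⟩ : LinJet n M)) h

end OneJets

/-! ### Reduced Lie subgroupoids, Lie subgroups -/

section Subobjects

variable {n k : ℕ} {M Γ : Type*} [TopologicalSpace M] [ChartedSpace (Rn n) M]
  [IsManifold (𝓡 n) ∞ M] [TopologicalSpace Γ] [ChartedSpace (Rn k) Γ]

/-- The groupoid `𝒢` on the `k`-dimensional manifold `Γ`, with inclusion map `ι`, is a reduced Lie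
subgroupoid of `Π¹(M, M)`: it is a transitive Lie groupoid over `M`, and `ι` is an injective
immersion and a morphism of groupoids over the identity of `M`. -/
structure IsReducedLieSubgroupoid (𝒢 : GroupoidOver M Γ) (ι : Γ → OneJet n M) : Prop where
  isLie : 𝒢.IsLie (𝓡 n) (𝓡 k)
  transitive : 𝒢.IsTransitive
  injective : Function.Injective ι
  immersion : IsImmersion (𝓡 k) (jetModel n) ∞ ι
  map_src : ∀ g, (jetGroupoid n M).src (ι g) = 𝒢.src g
  map_tgt : ∀ g, (jetGroupoid n M).tgt (ι g) = 𝒢.tgt g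
  map_mul : ∀ g h, 𝒢.src g = 𝒢.tgt h → ι (𝒢.mul g h) = (jetGroupoid n M).mul (ι g) (ι h)

end Subobjects

/-- The general linear group `GL(n, ℝ)`, with Mathlib's Lie group structure on the units of the
algebra of endomorphisms of `ℝⁿ`. -/
abbrev GLn (n : ℕ) := (Rn n →L[ℝ] Rn n)ˣ

/-- A Lie subgroup of `GL(n, ℝ)`: a Lie group with an injective immersive homomorphism to
`GL(n, ℝ)`. -/
structure LieSubgroup (n : ℕ) where
  carrier : Type
  dim : ℕ
  [group : Group carrier]
  [topology : TopologicalSpace carrier]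
  [charted : ChartedSpace (Rn dim) carrier]
  [lieGroup : LieGroup (𝓡 dim) ∞ carrier]
  [secondCountable : SecondCountableTopology carrier]
  incl : carrier →* GLn n
  injective : Function.Injective incl
  immersion : IsImmersion (𝓡 dim) 𝓘(ℝ, Rn n →L[ℝ] Rn n) ∞ incl

attribute [instance] LieSubgroup.group LieSubgroup.topology LieSubgroup.charted
  LieSubgroup.lieGroup LieSubgroup.secondCountable

/-! ### Integrability -/

section Integrability

variable {n k : ℕ} {M Γ : Type*} [TopologicalSpace M] [ChartedSpace (Rn n) M]
  [IsManifold (𝓡 n) ∞ M] [TopologicalSpace Γ] [ChartedSpace (Rn k) Γ]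

/-- The linear map `T_y ψ ∘ L ∘ (T_x φ)⁻¹` of `ℝⁿ` that corresponds in charts `φ` around `x` and `ψ`
around `y` to a jet `L : T_x M → T_y M`; for `L = j¹_{x,y} f` it is the 1-jet at `(0, 0)` of
`τ_{-ψ(y)} ∘ ψ ∘ f ∘ φ⁻¹ ∘ τ_{φ(x)}`. -/
def jetInCharts (φ ψ : OpenPartialHomeomorph M (Rn n)) (j : OneJet n M) : Rn n →L[ℝ] Rn n :=
  (mfderiv (𝓡 n) (𝓡 n) ψ j.tgt).comp
    (ContinuousLinearMap.comp (M₂ := Rn n) j.lin (mfderiv (𝓡 n) (𝓡 n) φ.symm (φ j.src)))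

/-- Diffeomorphisms between open sets of `Γ` and of the trivial groupoid `ℝⁿ × ℝⁿ × G`. -/
abbrev FlatDiffeo (k : ℕ) (Γ : Type*) [TopologicalSpace Γ] [ChartedSpace (Rn k) Γ]
    (n : ℕ) (G : LieSubgroup n) :=
  PartialDiffeomorph (𝓡 k) ((𝓡 n).prod ((𝓡 n).prod (𝓡 G.dim))) Γ (Rn n × Rn n × G.carrier) ∞

/-- The map `Ψ` is the map induced by the charts `φ` and `ψ`: on its domain it is
`(φ ∘ α, ψ ∘ β, Ψbar)`, with `α`, `β` source and target, and with `Ψbar` the expression of jets in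
the charts. -/
def IsInducedByCharts {G : LieSubgroup n} (𝒢 : GroupoidOver M Γ) (ι : Γ → OneJet n M)
    (φ ψ : OpenPartialHomeomorph M (Rn n)) (Ψ : FlatDiffeo k Γ n G) : Prop :=
  ∀ g ∈ Ψ.source, (Ψ g).1 = φ (𝒢.src g) ∧ (Ψ g).2.1 = ψ (𝒢.tgt g) ∧
    (G.incl (Ψ g).2.2 : Rn n →L[ℝ] Rn n) = jetInCharts φ ψ (ι g)

/-- `Γ` is locally diffeomorphic to `ℝⁿ × ℝⁿ × G`: for all `x`, `y` in `M` there are charts `φ`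
around `x` and `ψ` around `y`, with domains `U` and `V`, that induce a diffeomorphism from
the arrows from `U` to `V` onto `φ(U) × ψ(V) × G`. -/
def IsLocallyFlat (k : ℕ) {Γ : Type*} [TopologicalSpace Γ] [ChartedSpace (Rn k) Γ]
    (𝒢 : GroupoidOver M Γ) (ι : Γ → OneJet n M) (G : LieSubgroup n) : Prop :=
  ∀ x y : M, ∃ φ ∈ IsManifold.maximalAtlas (𝓡 n) ∞ M, ∃ ψ ∈ IsManifold.maximalAtlas (𝓡 n) ∞ M,
    x ∈ φ.source ∧ y ∈ ψ.source ∧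
    ∃ Ψ : FlatDiffeo k Γ n G, Ψ.source = 𝒢.arrows φ.source ψ.source ∧
      Ψ.target = φ.target ×ˢ ψ.target ×ˢ univ ∧ IsInducedByCharts 𝒢 ι φ ψ Ψ

/-- `Γ` is integrable: it is locally diffeomorphic to `ℝⁿ × ℝⁿ × G` for some Lie subgroup `G` of
`GL(n, ℝ)`. -/
def IsIntegrable (k : ℕ) {Γ : Type*} [TopologicalSpace Γ] [ChartedSpace (Rn k) Γ]
    (𝒢 : GroupoidOver M Γ) (ι : Γ → OneJet n M) : Prop :=
  ∃ G : LieSubgroup n, IsLocallyFlat k 𝒢 ι G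

/-- `M` is covered by charts `φ : U → φ(U)` each of which induces an isomorphism of Lie groupoids
over `φ` from the restriction of `Γ` to `U` onto the restriction to `φ(U)` of the standard flat
groupoid `ℝⁿ × ℝⁿ × G` over `ℝⁿ`. -/
def HasFlatAtlas (k : ℕ) {Γ : Type*} [TopologicalSpace Γ] [ChartedSpace (Rn k) Γ]
    (𝒢 : GroupoidOver M Γ) (ι : Γ → OneJet n M) (G : LieSubgroup n) : Prop :=
  ∃ 𝒜 : Set (OpenPartialHomeomorph M (Rn n)), 𝒜 ⊆ IsManifold.maximalAtlas (𝓡 n) ∞ M ∧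
    (⋃ φ ∈ 𝒜, φ.source) = univ ∧
    ∀ φ ∈ 𝒜, ∃ Ψ : FlatDiffeo k Γ n G,
      𝒢.IsLieIsoOn (GroupoidOver.trivial (Rn n) G.carrier) Ψ φ ∧ IsInducedByCharts 𝒢 ι φ φ Ψ

end Integrability

end JetGroupoids

end

/-! Both implications hold for each fixed `G`; integrability then follows by quantifying over `G`.
Reading jets in charts is multiplicative (`jetInCharts_comp`). Smoothness of the `G`-component needs
care: `G` is only immersed in `GL(n, ℝ)`, so smoothness of the derivative as a matrix is not enough.
Every `G`-valued map is therefore built from the `G`-component of a given diffeomorphism and from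
smooth groupoid or group operations.

From pairs of charts to an atlas (`exists_flatDiffeo_restr`): apply local flatness at `(x, x)`,
getting charts `φ`, `ψ` around `x`. On the common domain, units are arrows from the `φ`-domain to
the `ψ`-domain, and the `G`-component `c a` of the unit at `a` is the derivative of the change from
`φ` to `ψ`. So `c` is smooth into `G`, and left multiplication by its inverse at the target replaces
`ψ` by `φ`.

From an atlas to pairs of charts (`exists_flatDiffeo_of_sections`): transitivity gives an arrow from
`y` to `x`. A linear change of the chart at `x` makes it the identity in charts. Combined with
arrows that are the identity inside each flat chart, it moves any arrow between the two charts to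
the isotropy group at `y` without changing its matrix. There the flat chart around `y` supplies the
`G`-component. -/

namespace JetGroupoids

/-! ### Cancellation and smooth products in Lie groupoids -/

namespace GroupoidOver

variable {M Γ : Type*} (𝒢 : GroupoidOver M Γ)

theorem inv_mul_cancel_left {g h : Γ} (hgh : 𝒢.src g = 𝒢.tgt h) :
    𝒢.mul (𝒢.inv g) (𝒢.mul g h) = h := by
  rw [𝒢.mul_assoc _ _ _ (𝒢.src_inv g) hgh, 𝒢.inv_mul, hgh, 𝒢.one_mul]

theorem mul_inv_cancel_left {g h : Γ} (hgh : 𝒢.tgt g = 𝒢.tgt h) :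
    𝒢.mul g (𝒢.mul (𝒢.inv g) h) = h := by
  rw [𝒢.mul_assoc _ _ _ (𝒢.tgt_inv g).symm ((𝒢.src_inv g).trans hgh), 𝒢.mul_inv, hgh, 𝒢.one_mul]

theorem mul_inv_cancel_right {g h : Γ} (hgh : 𝒢.src g = 𝒢.tgt h) :
    𝒢.mul (𝒢.mul g h) (𝒢.inv h) = g := by
  rw [← 𝒢.mul_assoc _ _ _ hgh (𝒢.tgt_inv h).symm, 𝒢.mul_inv, ← hgh, 𝒢.mul_one]

theorem inv_mul_cancel_right {g h : Γ} (hgh : 𝒢.src g = 𝒢.src h) :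
    𝒢.mul (𝒢.mul g (𝒢.inv h)) h = g := by
  rw [← 𝒢.mul_assoc _ _ _ (hgh.trans (𝒢.tgt_inv h).symm) (𝒢.src_inv h), 𝒢.inv_mul, ← hgh,
    𝒢.mul_one]

section Smooth

variable {𝒢}
variable {E H E' H' E'' H'' N : Type*} [NormedAddCommGroup E] [NormedSpace ℝ E]
  [TopologicalSpace H] [NormedAddCommGroup E'] [NormedSpace ℝ E'] [TopologicalSpace H']
  [NormedAddCommGroup E''] [NormedSpace ℝ E''] [TopologicalSpace H'']
  {I : ModelWithCorners ℝ E H} {J : ModelWithCorners ℝ E' H'} {K : ModelWithCorners ℝ E'' H''}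
  [TopologicalSpace M] [ChartedSpace H M] [TopologicalSpace Γ] [ChartedSpace H' Γ]
  [TopologicalSpace N] [ChartedSpace H'' N]

/-- Multiplication is smooth only on composable pairs, so composability of the factors is exactly
what the chain rule within a set requires. -/
theorem IsLie.contMDiffOn_mul (h𝒢 : 𝒢.IsLie I J) {s : Set N} {f g : N → Γ}
    (hf : ContMDiffOn K J ∞ f s) (hg : ContMDiffOn K J ∞ g s)
    (hfg : ∀ z ∈ s, 𝒢.src (f z) = 𝒢.tgt (g z)) :
    ContMDiffOn K J ∞ (fun z => 𝒢.mul (f z) (g z)) s :=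
  h𝒢.mul_smooth.comp (hf.prodMk hg) hfg

theorem IsLie.contMDiffOn_inv (h𝒢 : 𝒢.IsLie I J) {s : Set N} {f : N → Γ}
    (hf : ContMDiffOn K J ∞ f s) : ContMDiffOn K J ∞ (fun z => 𝒢.inv (f z)) s :=
  h𝒢.inv_smooth.comp_contMDiffOn hf

end Smooth

end GroupoidOver

/-! ### Jets read in charts -/

section Jets

variable {n : ℕ} {M : Type*} [TopologicalSpace M] [ChartedSpace (Rn n) M]

theorem mdifferentiable_of_mem_maximalAtlas {φ : OpenPartialHomeomorph M (Rn n)}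
    (hφ : φ ∈ IsManifold.maximalAtlas (𝓡 n) ∞ M) : φ.MDifferentiable (𝓡 n) (𝓡 n) :=
  ⟨(contMDiffOn_of_mem_maximalAtlas hφ).mdifferentiableOn (by simp),
    (contMDiffOn_symm_of_mem_maximalAtlas hφ).mdifferentiableOn (by simp)⟩

variable [IsManifold (𝓡 n) ∞ M]

/-- At the midpoint the derivatives of `χ` and of its inverse cancel. The outer derivatives are only
carried along, so nothing is required of the endpoints. -/
theorem jetInCharts_comp {φ χ ψ : OpenPartialHomeomorph M (Rn n)}
    (hχ : χ ∈ IsManifold.maximalAtlas (𝓡 n) ∞ M) {j l : OneJet n M} (hjl : j.src = l.tgt)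
    (hj : j.src ∈ χ.source) :
    jetInCharts φ ψ (j.comp l) = (jetInCharts χ ψ j).comp (jetInCharts φ χ l) := by
  obtain ⟨⟨⟨y, z⟩, A⟩, hA⟩ := j
  obtain ⟨⟨⟨x, y'⟩, B⟩, hB⟩ := l
  obtain rfl : y = y' := hjl
  have hy : y ∈ χ.source := hj
  have key := (mdifferentiable_of_mem_maximalAtlas hχ).symm_comp_deriv hy
  ext1 v
  have key' := fun w : Rn n => DFunLike.congr_fun key w
  exact congrArg (fun w => mfderiv (𝓡 n) (𝓡 n) ψ z (A w)) (key' _).symm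

theorem isInvertible_jetInCharts {φ ψ : OpenPartialHomeomorph M (Rn n)}
    (hφ : φ ∈ IsManifold.maximalAtlas (𝓡 n) ∞ M) (hψ : ψ ∈ IsManifold.maximalAtlas (𝓡 n) ∞ M)
    {j : OneJet n M} (hs : j.src ∈ φ.source) (ht : j.tgt ∈ ψ.source) :
    (jetInCharts φ ψ j).IsInvertible := by
  have h1 : (mfderiv (𝓡 n) (𝓡 n) ψ j.tgt).IsInvertible :=
    ⟨(mdifferentiable_of_mem_maximalAtlas hψ).mfderiv ht, rfl⟩
  have h2 : (mfderiv (𝓡 n) (𝓡 n) φ.symm (φ j.src)).IsInvertible :=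
    ⟨(mdifferentiable_of_mem_maximalAtlas hφ).symm.mfderiv (φ.map_source hs), rfl⟩
  exact h1.comp (ContinuousLinearMap.IsInvertible.comp (M₂ := Rn n) j.lin_isInvertible h2)

theorem transHomeomorph_mem_maximalAtlas {φ : OpenPartialHomeomorph M (Rn n)}
    (hφ : φ ∈ IsManifold.maximalAtlas (𝓡 n) ∞ M) (e : Rn n ≃L[ℝ] Rn n) :
    φ.transHomeomorph e.toHomeomorph ∈ IsManifold.maximalAtlas (𝓡 n) ∞ M := by
  rw [IsManifold.mem_maximalAtlas_iff_contMDiffOn]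
  constructor
  · exact e.contDiff.contMDiff.comp_contMDiffOn (contMDiffOn_of_mem_maximalAtlas hφ)
  · exact (contMDiffOn_symm_of_mem_maximalAtlas hφ).comp e.symm.contDiff.contMDiff.contMDiffOn
      fun _ hp => hp

/-- Chain rule, with `e` its own derivative. This allows a chosen jet to be normalised to the
identity by changing the target chart. -/
theorem jetInCharts_transHomeomorph {φ ψ : OpenPartialHomeomorph M (Rn n)}
    (hψ : ψ ∈ IsManifold.maximalAtlas (𝓡 n) ∞ M) (e : Rn n ≃L[ℝ] Rn n)
    {j : OneJet n M} (ht : j.tgt ∈ ψ.source) :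
    jetInCharts φ (ψ.transHomeomorph e.toHomeomorph) j =
      (e : Rn n →L[ℝ] Rn n).comp (jetInCharts φ ψ j) := by
  have key : mfderiv (𝓡 n) (𝓡 n) (e ∘ ψ) j.tgt =
      (mfderiv (𝓡 n) (𝓡 n) e (ψ j.tgt)).comp (mfderiv (𝓡 n) (𝓡 n) ψ j.tgt) :=
    mfderiv_comp _ e.differentiableAt.mdifferentiableAt
      ((mdifferentiable_of_mem_maximalAtlas hψ).mdifferentiableAt ht)
  rw [mfderiv_eq_fderiv, e.fderiv] at key
  ext1 v
  exact DFunLike.congr_fun key (j.lin (mfderiv (𝓡 n) (𝓡 n) φ.symm (φ j.src) v))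

end Jets

end JetGroupoids

namespace JetGroupoids

/-! ### From pairs of charts to a flat atlas -/

section Integrability

variable {n k : ℕ} {M Γ : Type*} [TopologicalSpace M] [ChartedSpace (Rn n) M]
  [IsManifold (𝓡 n) ∞ M] [TopologicalSpace Γ] [ChartedSpace (Rn k) Γ]
  {𝒢 : GroupoidOver M Γ} {ι : Γ → OneJet n M} {G : LieSubgroup n}

/-- Identities in `G` can thus be checked between matrices, where the chain rule applies. -/
theorem LieSubgroup.incl_coe_injective (G : LieSubgroup n) :
    Function.Injective fun a : G.carrier => (G.incl a : Rn n →L[ℝ] Rn n) :=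
  Units.val_injective.comp G.injective

theorem IsInducedByCharts.src_invFun {φ ψ : OpenPartialHomeomorph M (Rn n)}
    {Ψ : FlatDiffeo k Γ n G} (hi : IsInducedByCharts 𝒢 ι φ ψ Ψ)
    (hs : Ψ.source = 𝒢.arrows φ.source ψ.source) {p : Rn n × Rn n × G.carrier}
    (hp : p ∈ Ψ.target) :
    𝒢.src (Ψ.invFun p) = φ.symm p.1 := by
  have hm : Ψ.invFun p ∈ 𝒢.arrows φ.source ψ.source := hs ▸ Ψ.map_target' hp
  have h1 := (hi _ (Ψ.map_target' hp)).1
  rw [Ψ.right_inv' hp] at h1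
  rw [h1, φ.left_inv hm.1]

theorem IsInducedByCharts.tgt_invFun {φ ψ : OpenPartialHomeomorph M (Rn n)}
    {Ψ : FlatDiffeo k Γ n G} (hi : IsInducedByCharts 𝒢 ι φ ψ Ψ)
    (hs : Ψ.source = 𝒢.arrows φ.source ψ.source) {p : Rn n × Rn n × G.carrier}
    (hp : p ∈ Ψ.target) :
    𝒢.tgt (Ψ.invFun p) = ψ.symm p.2.1 := by
  have hm : Ψ.invFun p ∈ 𝒢.arrows φ.source ψ.source := hs ▸ Ψ.map_target' hp
  have h1 := (hi _ (Ψ.map_target' hp)).2.1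
  rw [Ψ.right_inv' hp] at h1
  rw [h1, ψ.left_inv hm.2]

theorem IsReducedLieSubgroupoid.jetInCharts_mul (h : IsReducedLieSubgroupoid (k := k) 𝒢 ι)
    {φ χ ψ : OpenPartialHomeomorph M (Rn n)} (hχ : χ ∈ IsManifold.maximalAtlas (𝓡 n) ∞ M)
    {g₁ g₂ : Γ} (hg : 𝒢.src g₁ = 𝒢.tgt g₂) (hg₁ : 𝒢.src g₁ ∈ χ.source) :
    jetInCharts φ ψ (ι (𝒢.mul g₁ g₂)) =
      (jetInCharts χ ψ (ι g₁)).comp (jetInCharts φ χ (ι g₂)) := by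
  have h₁ : (ι g₁).src = 𝒢.src g₁ := h.map_src g₁
  have h₂ : (ι g₂).tgt = 𝒢.tgt g₂ := h.map_tgt g₂
  rw [h.map_mul _ _ hg]
  exact jetInCharts_comp hχ (by rw [h₁, h₂, hg]) (by rwa [h₁])

/-- A diffeomorphism onto a product with `G` induced by a single chart respects composition. -/
theorem IsReducedLieSubgroupoid.isLieIsoOn (h : IsReducedLieSubgroupoid (k := k) 𝒢 ι)
    {φ : OpenPartialHomeomorph M (Rn n)} (hφ : φ ∈ IsManifold.maximalAtlas (𝓡 n) ∞ M)
    {Ψ : FlatDiffeo k Γ n G} (hs : Ψ.source = 𝒢.arrows φ.source φ.source)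
    (ht : Ψ.target = φ.target ×ˢ φ.target ×ˢ univ) (hi : IsInducedByCharts 𝒢 ι φ φ Ψ) :
    𝒢.IsLieIsoOn (GroupoidOver.trivial (Rn n) G.carrier) Ψ φ where
  source_eq := hs
  target_eq := by
    rw [ht]
    ext p
    simp [GroupoidOver.arrows, GroupoidOver.trivial]
  map_src g hg := (hi g hg).1
  map_tgt g hg := (hi g hg).2.1
  map_mul g₁ hg₁ g₂ hg₂ hg := by
    have hm : 𝒢.mul g₁ g₂ ∈ Ψ.source := by
      rw [hs] at hg₁ hg₂ ⊢
      exact ⟨by rw [𝒢.src_mul _ _ hg]; exact hg₂.1, by rw [𝒢.tgt_mul _ _ hg]; exact hg₁.2⟩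
    have hχ : 𝒢.src g₁ ∈ φ.source := by
      rw [hs] at hg₁
      exact hg₁.1
    refine Prod.ext ?_ (Prod.ext ?_ (G.incl_coe_injective ?_))
    · rw [(hi _ hm).1, 𝒢.src_mul _ _ hg]
      exact (hi _ hg₂).1.symm
    · rw [(hi _ hm).2.1, 𝒢.tgt_mul _ _ hg]
      exact (hi _ hg₁).2.1.symm
    · have hmul : (G.incl ((Ψ g₁).2.2 * (Ψ g₂).2.2) : Rn n →L[ℝ] Rn n) =
          (G.incl (Ψ g₁).2.2 : Rn n →L[ℝ] Rn n).comp (G.incl (Ψ g₂).2.2 : Rn n →L[ℝ] Rn n) := by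
        rw [_root_.map_mul, Units.val_mul]
        rfl
      change (G.incl (Ψ (𝒢.mul g₁ g₂)).2.2 : Rn n →L[ℝ] Rn n) =
        (G.incl ((Ψ g₁).2.2 * (Ψ g₂).2.2) : Rn n →L[ℝ] Rn n)
      rw [hmul, (hi _ hm).2.2, (hi _ hg₁).2.2, (hi _ hg₂).2.2, h.jetInCharts_mul hφ hg hχ]

/-- If two charts `φ`, `ψ` induce a diffeomorphism onto a product with `G`, then so does `φ`,
restricted to the intersection of their domains, alone: the coordinate change from `φ` to `ψ`
has its derivatives in `G`. -/
theorem IsReducedLieSubgroupoid.exists_flatDiffeo_restr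
    (h : IsReducedLieSubgroupoid (k := k) 𝒢 ι) {φ ψ : OpenPartialHomeomorph M (Rn n)}
    (hφ : φ ∈ IsManifold.maximalAtlas (𝓡 n) ∞ M) (hψ : ψ ∈ IsManifold.maximalAtlas (𝓡 n) ∞ M)
    (Ψ : FlatDiffeo k Γ n G) (hs : Ψ.source = 𝒢.arrows φ.source ψ.source)
    (ht : Ψ.target = φ.target ×ˢ ψ.target ×ˢ univ) (hi : IsInducedByCharts 𝒢 ι φ ψ Ψ) :
    ∃ Ψ' : FlatDiffeo k Γ n G,
      Ψ'.source = 𝒢.arrows (φ.restr ψ.source).source (φ.restr ψ.source).source ∧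
      Ψ'.target = (φ.restr ψ.source).target ×ˢ (φ.restr ψ.source).target ×ˢ univ ∧
      IsInducedByCharts 𝒢 ι (φ.restr ψ.source) (φ.restr ψ.source) Ψ' := by
  set χ := φ.restr ψ.source with hχ
  have hsrc : χ.source = φ.source ∩ ψ.source := by
    rw [hχ, φ.restr_source, ψ.open_source.interior_eq]
  have hχφ : χ.target ⊆ φ.target := inter_subset_left
  have hsymm : ∀ p ∈ χ.target, φ.symm p ∈ χ.source := fun p hp => χ.map_target hp
  have hmaps : ∀ x ∈ χ.source, φ x ∈ χ.target := fun x hx => χ.map_source hx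
  have hφsymm : ∀ p ∈ χ.target, φ (φ.symm p) = p := fun p hp => φ.right_inv (hχφ hp)
  have hone : ∀ x ∈ χ.source, 𝒢.one x ∈ Ψ.source := by
    intro x hx
    rw [hsrc] at hx
    rw [hs]
    exact ⟨by rw [𝒢.src_one]; exact hx.1, by rw [𝒢.tgt_one]; exact hx.2⟩
  have hsub : 𝒢.arrows χ.source χ.source ⊆ Ψ.source := by
    rw [hs, hsrc]
    exact fun g hg => ⟨hg.1.1, hg.2.2⟩
  -- The derivative of the coordinate change from `φ` to `ψ`, obtained as the `G`-component of a
  -- unit and hence smooth into `G` itself.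
  let c : M → G.carrier := fun x => (Ψ (𝒢.one x)).2.2
  have hc : ContMDiffOn (𝓡 n) (𝓡 G.dim) ∞ c χ.source :=
    contMDiff_snd.comp_contMDiffOn (contMDiff_snd.comp_contMDiffOn
      (Ψ.contMDiffOn_toFun.comp h.isLie.one_smooth.contMDiffOn hone))
  have hjet : ∀ g ∈ 𝒢.arrows χ.source χ.source,
      (G.incl ((c (𝒢.tgt g))⁻¹ * (Ψ g).2.2) : Rn n →L[ℝ] Rn n) = jetInCharts χ χ (ι g) := by
    intro g hg
    have hu : (G.incl (c (𝒢.tgt g)) : Rn n →L[ℝ] Rn n) * jetInCharts χ χ (ι g) =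
        (G.incl (Ψ g).2.2 : Rn n →L[ℝ] Rn n) := by
      rw [(hi g (hsub hg)).2.2, (hi _ (hone _ hg.2)).2.2]
      -- Factor `g` as the unit at its target times `g`, reading the midpoint in `φ`. Restriction
      -- leaves the maps of `φ` unchanged, so `χ` and `φ` give the same matrix.
      have := h.jetInCharts_mul (φ := φ) (ψ := ψ) hφ (𝒢.src_one (𝒢.tgt g))
        (by rw [𝒢.src_one]; exact (hsrc ▸ hg.2).1)
      rw [𝒢.one_mul] at this
      exact this.symm
    rw [_root_.map_mul, map_inv, Units.val_mul, ← hu, Units.inv_mul_cancel_left]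
  -- The inverse undoes the correction: pass from `φ` to `ψ` in the target coordinate and multiply
  -- by `c` there.
  have hmk : ∀ p ∈ χ.target ×ˢ χ.target ×ˢ (univ : Set G.carrier),
      (p.1, ψ (φ.symm p.2.1), c (φ.symm p.2.1) * p.2.2) ∈ Ψ.target := by
    rintro p ⟨hp1, hp2, -⟩
    rw [ht]
    exact ⟨hχφ hp1, ψ.map_source (hsrc ▸ hsymm _ hp2).2, mem_univ _⟩
  have hinv : ∀ p ∈ χ.target ×ˢ χ.target ×ˢ (univ : Set G.carrier), ∀ g,
      g = Ψ.invFun (p.1, ψ (φ.symm p.2.1), c (φ.symm p.2.1) * p.2.2) →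
      𝒢.src g = φ.symm p.1 ∧ 𝒢.tgt g = φ.symm p.2.1 ∧
        Ψ g = (p.1, ψ (φ.symm p.2.1), c (φ.symm p.2.1) * p.2.2) := by
    rintro p hp g rfl
    exact ⟨hi.src_invFun hs (hmk p hp),
      (hi.tgt_invFun hs (hmk p hp)).trans (ψ.left_inv (hsrc ▸ hsymm _ hp.2.1).2),
      Ψ.right_inv' (hmk p hp)⟩
  have hφs : ContMDiffOn (𝓡 n) (𝓡 n) ∞ φ χ.source :=
    (contMDiffOn_of_mem_maximalAtlas hφ).mono (by rw [hsrc]; exact inter_subset_left)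
  have hφt : ContMDiffOn ((𝓡 n).prod ((𝓡 n).prod (𝓡 G.dim))) (𝓡 n) ∞
      (fun p : Rn n × Rn n × G.carrier => φ.symm p.2.1)
      (χ.target ×ˢ χ.target ×ˢ (univ : Set G.carrier)) :=
    ((contMDiffOn_symm_of_mem_maximalAtlas hφ).mono hχφ).comp
      (contMDiff_fst.comp contMDiff_snd).contMDiffOn fun p hp => hp.2.1
  refine ⟨{
    toFun := fun g => (φ (𝒢.src g), φ (𝒢.tgt g), (c (𝒢.tgt g))⁻¹ * (Ψ g).2.2)
    invFun := fun p => Ψ.invFun (p.1, ψ (φ.symm p.2.1), c (φ.symm p.2.1) * p.2.2)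
    source := 𝒢.arrows χ.source χ.source
    target := χ.target ×ˢ χ.target ×ˢ univ
    map_source' := fun g hg => ⟨hmaps _ hg.1, hmaps _ hg.2, mem_univ _⟩
    map_target' := ?_
    left_inv' := ?_
    right_inv' := ?_
    open_source := ?_
    open_target := χ.open_target.prod (χ.open_target.prod isOpen_univ)
    contMDiffOn_toFun := ?_
    contMDiffOn_invFun := ?_ }, rfl, rfl, fun g hg => ⟨rfl, rfl, hjet g hg⟩⟩
  · intro p hp
    obtain ⟨h1, h2, -⟩ := hinv p hp _ rfl
    exact ⟨by rw [h1]; exact hsymm _ hp.1, by rw [h2]; exact hsymm _ hp.2.1⟩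
  · intro g hg
    have hl : φ.symm (φ (𝒢.tgt g)) = 𝒢.tgt g := χ.left_inv hg.2
    have hi' := hi g (hsub hg)
    dsimp only
    rw [hl, mul_inv_cancel_left, ← hi'.1, ← hi'.2.1]
    exact Ψ.left_inv' (hsub hg)
  · intro p hp
    obtain ⟨h1, h2, h3⟩ := hinv p hp _ rfl
    rw [h1, h2, h3, hφsymm _ hp.1, hφsymm _ hp.2.1, inv_mul_cancel_left]
  · exact (χ.open_source.preimage h.isLie.src_submersion.contMDiff.continuous).inter
      (χ.open_source.preimage h.isLie.tgt_submersion.contMDiff.continuous)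
  · refine (hφs.comp h.isLie.src_submersion.contMDiff.contMDiffOn fun g hg => hg.1).prodMk
      ((hφs.comp h.isLie.tgt_submersion.contMDiff.contMDiffOn fun g hg => hg.2).prodMk ?_)
    exact (hc.comp h.isLie.tgt_submersion.contMDiff.contMDiffOn fun g hg => hg.2).inv.mul
      (contMDiff_snd.comp_contMDiffOn (contMDiff_snd.comp_contMDiffOn
        (Ψ.contMDiffOn_toFun.mono hsub)))
  · refine Ψ.contMDiffOn_invFun.comp (contMDiff_fst.contMDiffOn.prodMk (ContMDiffOn.prodMk ?_ ?_))
      hmk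
    · exact (contMDiffOn_of_mem_maximalAtlas hψ).comp hφt
        fun p hp => (hsrc ▸ hsymm _ hp.2.1).2
    · exact (hc.comp hφt fun p hp => hsymm _ hp.2.1).mul
        (contMDiff_snd.comp contMDiff_snd).contMDiffOn

/-- Only the diagonal case of local flatness is needed: both charts then contain `x`, so their
common domains cover `M`. -/
theorem IsReducedLieSubgroupoid.hasFlatAtlas (h : IsReducedLieSubgroupoid (k := k) 𝒢 ι)
    (hG : IsLocallyFlat k 𝒢 ι G) : HasFlatAtlas k 𝒢 ι G := by
  choose φ hφ ψ hψ hxφ hxψ Ψ hs ht hi using fun x => hG x x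
  refine ⟨range fun x => (φ x).restr (ψ x).source, ?_, ?_, ?_⟩
  · rintro _ ⟨x, rfl⟩
    exact restr_mem_maximalAtlas _ (hφ x) (ψ x).open_source
  · refine eq_univ_of_forall fun x => mem_biUnion (mem_range_self x) ?_
    rw [OpenPartialHomeomorph.restr_source, (ψ x).open_source.interior_eq]
    exact ⟨hxφ x, hxψ x⟩
  · rintro _ ⟨x, rfl⟩
    obtain ⟨Ψ', hs', ht', hi'⟩ :=
      h.exists_flatDiffeo_restr (hφ x) (hψ x) (Ψ x) (hs x) (ht x) (hi x)
    exact ⟨Ψ', h.isLieIsoOn (restr_mem_maximalAtlas _ (hφ x) (ψ x).open_source) hs' ht' hi', hi'⟩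

end Integrability

end JetGroupoids

namespace JetGroupoids

/-! ### From a flat atlas to pairs of charts -/

section LocallyFlat

variable {n k : ℕ} {M Γ : Type*} [TopologicalSpace M] [ChartedSpace (Rn n) M]
  [IsManifold (𝓡 n) ∞ M] [TopologicalSpace Γ] [ChartedSpace (Rn k) Γ]
  {𝒢 : GroupoidOver M Γ} {ι : Γ → OneJet n M} {G : LieSubgroup n}

/-- In a flat chart there is a smooth family of arrows, with any prescribed sources and targets,
that are the identity in the chart. -/
theorem exists_flat_section {φ : OpenPartialHomeomorph M (Rn n)}
    (hφ : φ ∈ IsManifold.maximalAtlas (𝓡 n) ∞ M) (Φ : FlatDiffeo k Γ n G)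
    (hs : Φ.source = 𝒢.arrows φ.source φ.source) (ht : Φ.target = φ.target ×ˢ φ.target ×ˢ univ)
    (hi : IsInducedByCharts 𝒢 ι φ φ Φ) {u v : M → M} (hu : ContMDiff (𝓡 n) (𝓡 n) ∞ u)
    (hv : ContMDiff (𝓡 n) (𝓡 n) ∞ v) (hum : MapsTo u φ.source φ.source)
    (hvm : MapsTo v φ.source φ.source) :
    ∃ s : M → Γ, ContMDiffOn (𝓡 n) (𝓡 k) ∞ s φ.source ∧
      ∀ a ∈ φ.source, 𝒢.src (s a) = u a ∧ 𝒢.tgt (s a) = v a ∧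
        jetInCharts φ φ (ι (s a)) = .id ℝ (Rn n) := by
  have hφs := contMDiffOn_of_mem_maximalAtlas hφ
  have hm : MapsTo (fun a => (φ (u a), φ (v a), (1 : G.carrier))) φ.source Φ.target := by
    intro a ha
    rw [ht]
    exact ⟨φ.map_source (hum ha), φ.map_source (hvm ha), mem_univ _⟩
  refine ⟨fun a => Φ.invFun (φ (u a), φ (v a), 1), ?_, fun a ha => ⟨?_, ?_, ?_⟩⟩
  · exact Φ.contMDiffOn_invFun.comp ((hφs.comp hu.contMDiffOn hum).prodMk
      ((hφs.comp hv.contMDiffOn hvm).prodMk contMDiffOn_const)) hm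
  · exact (hi.src_invFun hs (hm ha)).trans (φ.left_inv (hum ha))
  · exact (hi.tgt_invFun hs (hm ha)).trans (φ.left_inv (hvm ha))
  · have h1 := (hi _ (Φ.map_target' (hm ha))).2.2
    rw [Φ.right_inv' (hm ha), map_one] at h1
    exact h1.symm

/-- Left and right multiplication with smooth families of arrows to and from `y`, which are the
identity in the charts, transports a flat chart `ψ` around `y` to a pair `φ`, `ψ` of flat charts. -/
theorem IsReducedLieSubgroupoid.exists_flatDiffeo_of_sections
    (h : IsReducedLieSubgroupoid (k := k) 𝒢 ι) {φ ψ : OpenPartialHomeomorph M (Rn n)}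
    (hφ : φ ∈ IsManifold.maximalAtlas (𝓡 n) ∞ M) (hψ : ψ ∈ IsManifold.maximalAtlas (𝓡 n) ∞ M)
    (Ψ : FlatDiffeo k Γ n G) (hs : Ψ.source = 𝒢.arrows ψ.source ψ.source)
    (ht : Ψ.target = ψ.target ×ˢ ψ.target ×ˢ univ) (hi : IsInducedByCharts 𝒢 ι ψ ψ Ψ)
    {y : M} (hy : y ∈ ψ.source) {r t : M → Γ}
    (hr : ContMDiffOn (𝓡 n) (𝓡 k) ∞ r φ.source) (ht' : ContMDiffOn (𝓡 n) (𝓡 k) ∞ t ψ.source)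
    (hra : ∀ a ∈ φ.source, 𝒢.src (r a) = y ∧ 𝒢.tgt (r a) = a ∧
      jetInCharts ψ φ (ι (r a)) = .id ℝ (Rn n))
    (htb : ∀ b ∈ ψ.source, 𝒢.src (t b) = b ∧ 𝒢.tgt (t b) = y ∧
      jetInCharts ψ ψ (ι (t b)) = .id ℝ (Rn n)) :
    ∃ Ψ' : FlatDiffeo k Γ n G, Ψ'.source = 𝒢.arrows φ.source ψ.source ∧
      Ψ'.target = φ.target ×ˢ ψ.target ×ˢ univ ∧ IsInducedByCharts 𝒢 ι φ ψ Ψ' := by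
  have hsrcs : ContMDiff (𝓡 k) (𝓡 n) ∞ 𝒢.src := h.isLie.src_submersion.contMDiff
  have htgts : ContMDiff (𝓡 k) (𝓡 n) ∞ 𝒢.tgt := h.isLie.tgt_submersion.contMDiff
  -- `w` moves an arrow to the isotropy group at `y`, `z` picks the isotropy arrow with a given
  -- `G`-component, and `m` moves it back to the prescribed endpoints.
  let w : Γ → Γ := fun g => 𝒢.mul (t (𝒢.tgt g)) (𝒢.mul g (r (𝒢.src g)))
  let z : Rn n × Rn n × G.carrier → Γ := fun p => Ψ.invFun (ψ y, ψ y, p.2.2)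
  let m : Rn n × Rn n × G.carrier → Γ := fun p =>
    𝒢.mul (𝒢.mul (𝒢.inv (t (ψ.symm p.2.1))) (z p)) (𝒢.inv (r (φ.symm p.1)))
  have hgr : ∀ g ∈ 𝒢.arrows φ.source ψ.source, 𝒢.src g = 𝒢.tgt (r (𝒢.src g)) :=
    fun g hg => (hra _ hg.1).2.1.symm
  have htg : ∀ g ∈ 𝒢.arrows φ.source ψ.source,
      𝒢.src (t (𝒢.tgt g)) = 𝒢.tgt (𝒢.mul g (r (𝒢.src g))) := by
    intro g hg
    rw [𝒢.tgt_mul _ _ (hgr g hg), (htb _ hg.2).1]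
  have hwsrc : ∀ g ∈ 𝒢.arrows φ.source ψ.source, 𝒢.src (w g) = y := by
    intro g hg
    rw [𝒢.src_mul _ _ (htg g hg), 𝒢.src_mul _ _ (hgr g hg), (hra _ hg.1).1]
  have hwtgt : ∀ g ∈ 𝒢.arrows φ.source ψ.source, 𝒢.tgt (w g) = y := by
    intro g hg
    rw [𝒢.tgt_mul _ _ (htg g hg), (htb _ hg.2).2.1]
  have hwm : MapsTo w (𝒢.arrows φ.source ψ.source) Ψ.source := by
    intro g hg
    rw [hs]
    exact ⟨by rw [hwsrc g hg]; exact hy, by rw [hwtgt g hg]; exact hy⟩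
  have hzt : ∀ p : Rn n × Rn n × G.carrier, (ψ y, ψ y, p.2.2) ∈ Ψ.target := by
    intro p
    rw [ht]
    exact ⟨ψ.map_source hy, ψ.map_source hy, mem_univ _⟩
  have hzsrc : ∀ p, 𝒢.src (z p) = y := fun p =>
    (hi.src_invFun hs (hzt p)).trans (ψ.left_inv hy)
  have hztgt : ∀ p, 𝒢.tgt (z p) = y := fun p =>
    (hi.tgt_invFun hs (hzt p)).trans (ψ.left_inv hy)
  have htz : ∀ p ∈ φ.target ×ˢ ψ.target ×ˢ (univ : Set G.carrier),
      𝒢.src (𝒢.inv (t (ψ.symm p.2.1))) = 𝒢.tgt (z p) := by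
    intro p hp
    rw [𝒢.src_inv, hztgt, (htb _ (ψ.map_target hp.2.1)).2.1]
  have hzr : ∀ p ∈ φ.target ×ˢ ψ.target ×ˢ (univ : Set G.carrier),
      𝒢.src (𝒢.mul (𝒢.inv (t (ψ.symm p.2.1))) (z p)) = 𝒢.tgt (𝒢.inv (r (φ.symm p.1))) := by
    intro p hp
    rw [𝒢.src_mul _ _ (htz p hp), hzsrc, 𝒢.tgt_inv, (hra _ (φ.map_target hp.1)).1]
  have hmsrc : ∀ p ∈ φ.target ×ˢ ψ.target ×ˢ (univ : Set G.carrier),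
      𝒢.src (m p) = φ.symm p.1 := by
    intro p hp
    rw [𝒢.src_mul _ _ (hzr p hp), 𝒢.src_inv, (hra _ (φ.map_target hp.1)).2.1]
  have hmtgt : ∀ p ∈ φ.target ×ˢ ψ.target ×ˢ (univ : Set G.carrier),
      𝒢.tgt (m p) = ψ.symm p.2.1 := by
    intro p hp
    rw [𝒢.tgt_mul _ _ (hzr p hp), 𝒢.tgt_mul _ _ (htz p hp), 𝒢.tgt_inv,
      (htb _ (ψ.map_target hp.2.1)).1]
  have hwm_eq : ∀ p ∈ φ.target ×ˢ ψ.target ×ˢ (univ : Set G.carrier), w (m p) = z p := by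
    intro p hp
    dsimp only [w]
    rw [hmsrc p hp, hmtgt p hp]
    dsimp only [m]
    rw [𝒢.inv_mul_cancel_right ((𝒢.src_mul _ _ (htz p hp)).trans
      ((hzsrc p).trans (hra _ (φ.map_target hp.1)).1.symm)),
      𝒢.mul_inv_cancel_left ((htb _ (ψ.map_target hp.2.1)).2.1.trans (hztgt p).symm)]
  have hjet : ∀ g ∈ 𝒢.arrows φ.source ψ.source,
      (G.incl (Ψ (w g)).2.2 : Rn n →L[ℝ] Rn n) = jetInCharts φ ψ (ι g) := by
    intro g hg
    -- Split the triple product at the two endpoints of `g`; both outer factors are the identity in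
    -- charts.
    rw [(hi _ (hwm hg)).2.2, h.jetInCharts_mul hψ (htg g hg)
      (by rw [(htb _ hg.2).1]; exact hg.2), h.jetInCharts_mul hφ (hgr g hg) hg.1,
      (htb _ hg.2).2.2, (hra _ hg.1).2.2]
    rfl
  refine ⟨{
    toFun := fun g => (φ (𝒢.src g), ψ (𝒢.tgt g), (Ψ (w g)).2.2)
    invFun := m
    source := 𝒢.arrows φ.source ψ.source
    target := φ.target ×ˢ ψ.target ×ˢ univ
    map_source' := fun g hg => ⟨φ.map_source hg.1, ψ.map_source hg.2, mem_univ _⟩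
    map_target' := fun p hp => ⟨by rw [hmsrc p hp]; exact φ.map_target hp.1,
      by rw [hmtgt p hp]; exact ψ.map_target hp.2.1⟩
    left_inv' := ?_
    right_inv' := ?_
    open_source := ?_
    open_target := φ.open_target.prod (ψ.open_target.prod isOpen_univ)
    contMDiffOn_toFun := ?_
    contMDiffOn_invFun := ?_ }, rfl, rfl, fun g hg => ⟨rfl, rfl, hjet g hg⟩⟩
  · intro g hg
    have hz : z (φ (𝒢.src g), ψ (𝒢.tgt g), (Ψ (w g)).2.2) = w g := by
      have hi' := hi _ (hwm hg)
      -- Both ends of `w g` are `y`, so its `G`-component alone determines it.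
      have hΨ : Ψ (w g) = (ψ y, ψ y, (Ψ (w g)).2.2) :=
        Prod.ext (by rw [hi'.1, hwsrc g hg]) (Prod.ext (by rw [hi'.2.1, hwtgt g hg]) rfl)
      exact (congrArg Ψ.invFun hΨ).symm.trans (Ψ.left_inv' (hwm hg))
    dsimp only [m]
    rw [hz, φ.left_inv hg.1, ψ.left_inv hg.2, 𝒢.inv_mul_cancel_left (htg g hg),
      𝒢.mul_inv_cancel_right (hgr g hg)]
  · intro p hp
    have hΨ : Ψ (z p) = (ψ y, ψ y, p.2.2) := Ψ.right_inv' (hzt p)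
    rw [hwm_eq p hp, hmsrc p hp, hmtgt p hp, hΨ, φ.right_inv hp.1, ψ.right_inv hp.2.1]
  · exact (φ.open_source.preimage hsrcs.continuous).inter
      (ψ.open_source.preimage htgts.continuous)
  · have hw : ContMDiffOn (𝓡 k) (𝓡 k) ∞ w (𝒢.arrows φ.source ψ.source) :=
      h.isLie.contMDiffOn_mul (ht'.comp htgts.contMDiffOn fun g hg => hg.2)
        (h.isLie.contMDiffOn_mul contMDiffOn_id (hr.comp hsrcs.contMDiffOn fun g hg => hg.1) hgr)
        htg
    exact ((contMDiffOn_of_mem_maximalAtlas hφ).comp hsrcs.contMDiffOn fun g hg => hg.1).prodMk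
      (((contMDiffOn_of_mem_maximalAtlas hψ).comp htgts.contMDiffOn fun g hg => hg.2).prodMk
        (contMDiff_snd.comp_contMDiffOn (contMDiff_snd.comp_contMDiffOn
          (Ψ.contMDiffOn_toFun.comp hw hwm))))
  · have hz : ContMDiff ((𝓡 n).prod ((𝓡 n).prod (𝓡 G.dim))) (𝓡 k) ∞ z :=
      contMDiffOn_univ.1 (Ψ.contMDiffOn_invFun.comp (contMDiff_const.prodMk
        (contMDiff_const.prodMk (contMDiff_snd.comp contMDiff_snd))).contMDiffOn
        fun p _ => hzt p)
    have hφt := (contMDiffOn_symm_of_mem_maximalAtlas hφ).comp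
      (contMDiff_fst (I := 𝓡 n) (J := (𝓡 n).prod (𝓡 G.dim))
        (N := Rn n × G.carrier)).contMDiffOn
      (s := φ.target ×ˢ ψ.target ×ˢ (univ : Set G.carrier)) fun p hp => hp.1
    have hψt := (contMDiffOn_symm_of_mem_maximalAtlas hψ).comp
      ((contMDiff_fst (I := 𝓡 n) (J := 𝓡 G.dim) (N := G.carrier)).comp
        (contMDiff_snd (I := 𝓡 n) (J := (𝓡 n).prod (𝓡 G.dim)) (M := Rn n))).contMDiffOn
      (s := φ.target ×ˢ ψ.target ×ˢ (univ : Set G.carrier)) fun p hp => hp.2.1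
    exact h.isLie.contMDiffOn_mul (h.isLie.contMDiffOn_mul (h.isLie.contMDiffOn_inv
      (ht'.comp hψt fun p hp => ψ.map_target hp.2.1)) hz.contMDiffOn htz)
      (h.isLie.contMDiffOn_inv (hr.comp hφt fun p hp => φ.map_target hp.1)) hzr

/-- Transitivity enters here, linking two unrelated flat charts by one arrow. The chart at `x`
serves only to spread this arrow over its domain; the `G`-component comes from the chart at `y`. -/
theorem IsReducedLieSubgroupoid.isLocallyFlat (h : IsReducedLieSubgroupoid (k := k) 𝒢 ι)
    (hG : HasFlatAtlas k 𝒢 ι G) : IsLocallyFlat k 𝒢 ι G := by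
  obtain ⟨𝒜, h𝒜, hcov, hflat⟩ := hG
  have chart : ∀ x : M, ∃ φ ∈ IsManifold.maximalAtlas (𝓡 n) ∞ M, x ∈ φ.source ∧
      ∃ Φ : FlatDiffeo k Γ n G, Φ.source = 𝒢.arrows φ.source φ.source ∧
        Φ.target = φ.target ×ˢ φ.target ×ˢ univ ∧ IsInducedByCharts 𝒢 ι φ φ Φ := by
    intro x
    obtain ⟨φ, hφ, hx⟩ := mem_iUnion₂.1 (hcov ▸ mem_univ x : x ∈ ⋃ φ ∈ 𝒜, φ.source)
    obtain ⟨Φ, hiso, hi⟩ := hflat φ hφ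
    refine ⟨φ, h𝒜 hφ, hx, Φ, hiso.source_eq, hiso.target_eq.trans ?_, hi⟩
    ext p
    simp [GroupoidOver.arrows, GroupoidOver.trivial]
  intro x y
  obtain ⟨φ, hφ, hx, Φ, hsφ, htφ, hiφ⟩ := chart x
  obtain ⟨ψ, hψ, hy, Ψ, hsψ, htψ, hiψ⟩ := chart y
  obtain ⟨g, hgy, hgx⟩ := h.transitive y x
  have hjs : (ι g).src = y := (h.map_src g).trans hgy
  have hjt : (ι g).tgt = x := (h.map_tgt g).trans hgx
  -- No membership of `e` in `G` is needed: it is absorbed into the chart at `x`, whose domain stays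
  -- the same.
  obtain ⟨e, he⟩ := isInvertible_jetInCharts hψ hφ (hjs ▸ hy) (hjt ▸ hx)
  obtain ⟨s, hs, hs'⟩ := exists_flat_section hφ Φ hsφ htφ hiφ (u := fun _ => x) (v := id)
    contMDiff_const contMDiff_id (fun _ _ => hx) (mapsTo_id _)
  obtain ⟨t, ht, ht'⟩ := exists_flat_section hψ Ψ hsψ htψ hiψ (u := id) (v := fun _ => y)
    contMDiff_id contMDiff_const (mapsTo_id _) (fun _ _ => hy)
  have hsg : ∀ a ∈ φ.source, 𝒢.src (s a) = 𝒢.tgt g := fun a ha => (hs' a ha).1.trans hgx.symm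
  have hφ' := transHomeomorph_mem_maximalAtlas hφ e.symm
  refine ⟨φ.transHomeomorph e.symm.toHomeomorph, hφ', ψ, hψ, hx, hy,
    h.exists_flatDiffeo_of_sections hφ' hψ Ψ hsψ htψ hiψ hy (r := fun a => 𝒢.mul (s a) g)
      (t := t) (h.isLie.contMDiffOn_mul hs contMDiffOn_const hsg) ht (fun a ha => ?_) ht'⟩
  have ha' : a ∈ φ.source := ha
  have htgt : 𝒢.tgt (𝒢.mul (s a) g) = a := (𝒢.tgt_mul _ _ (hsg a ha)).trans (hs' a ha).2.1
  refine ⟨(𝒢.src_mul _ _ (hsg a ha)).trans hgy, htgt, ?_⟩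
  have hjt' : (ι (𝒢.mul (s a) g)).tgt = a := (h.map_tgt _).trans htgt
  -- In the new chart the arrow `s a` after `g` reads as the inverse of `e`, times the identity,
  -- times `e`.
  rw [jetInCharts_transHomeomorph hφ e.symm (by rw [hjt']; exact ha'),
    h.jetInCharts_mul hφ (hsg a ha) (by rw [(hs' a ha).1]; exact hx), (hs' a ha).2.2, ← he]
  ext1 v
  exact e.symm_apply_apply v

end LocallyFlat

end JetGroupoids

open JetGroupoids in
theorem proposition54 {n k : ℕ} {M Γ : Type*}
    [TopologicalSpace M] [ChartedSpace (Rn n) M] [IsManifold (𝓡 n) ∞ M]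
    [TopologicalSpace Γ] [ChartedSpace (Rn k) Γ] [IsManifold (𝓡 k) ∞ Γ]
    (𝒢 : GroupoidOver M Γ) (ι : Γ → OneJet n M)
    (h : IsReducedLieSubgroupoid (k := k) 𝒢 ι) :
    (IsIntegrable k 𝒢 ι ↔ ∃ G : LieSubgroup n, HasFlatAtlas k 𝒢 ι G) ∧
    ∀ G : LieSubgroup n, IsLocallyFlat k 𝒢 ι G ↔ HasFlatAtlas k 𝒢 ι G := by
  have key : ∀ G : LieSubgroup n, IsLocallyFlat k 𝒢 ι G ↔ HasFlatAtlas k 𝒢 ι G :=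
    fun G => ⟨h.hasFlatAtlas, h.isLocallyFlat⟩
  exact ⟨exists_congr key, key⟩
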